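/- Fix a set $\Sigma$ of colors. In infinite Mastermind, the codemaker hides a codeword $w\in{}^\omega\Sigma$ and at each ordinal stage $\alpha$ the codebreaker plays a guessword $s\in{}^\omega\Sigma$ and receives feedback about $s$ and $w$; she wins at stage $\alpha$ if her guessword at stage $\alpha$ is $w$. In the no-duplication variants all codewords and guesswords are injective sequences; in the duplication-allowed variants they are arbitrary. The feedback is: full: the triple $(\kappa,\rho,\varepsilon)$, where $\kappa=\|s=w\|=|\{n: s(n)=w(n)\}|$ is the correctness count and, over all permutations $\pi$ of the set $I=\{n:s(n)\neq w(n)\}$, $\rho$ is the maximum of $|\{n\in I:s(\pi(n))=w(n)\}|$ and $\varepsilon$ is the minimum of $|\{n\in I:s(\pi(n))\neq w(n)\}|$; simplified: the pair $(\|s=w\|,\|s\neq w\|)$, where $\|s\neq w\|=|\{n:s(n)\neq w(n)\}|$; correctness-only: $\|s=w\|$; incorrectness-only: $\|s\neq w\|$. A set of guesswords is winning if every codeword is uniquely determined by the feedback to the guesswords in the set; the mastermind number of a variant is the smallest cardinality of a winning set. A strategy determines the guessword at each ordinal stage from the feedback received at all earlier stages; the strategic mastermind number of a variant is the least ordinal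 $\gamma$ such that the codebreaker has a strategy that guesses every codeword at some stage before $\gamma$. Cardinals are identified with initial ordinals. Let $\mathrm{cov}(\mathcal M)$ be the smallest size of a family of meager sets covering Baire space ${}^\omega\omega$, and let $\mathfrak m(\mathbb C)$ be the smallest size of a family of dense subsets of Cohen forcing $\mathbb C={}^{<\omega}\omega$ (finite sequences, ordered by end-extension) such that no filter on $\mathbb C$ meets every set in the family. Theorem. (1) For duplication-allowed Mastermind with full feedback, with countably infinitely many colors or with any finite number $n\ge2$ of colors, the strategic mastermind number is $\omega+1$. (2) For no-duplication Mastermind with countably infinitely many colors and with full, simplified or correctness-only feedback, the strategic mastermind number is equal to the corresponding mastermind number, and all six of these numbers are equal to $\mathrm{cov}(\mathcal M)=\mathfrak m(\mathbb C)$. (3) For duplication-allowed Mastermind with countably infinitely many colors and with simplified or correctness-only feedback, the strategic mastermind number is equal to the corresponding mastermind number, and all four of these numbers are equal to $\mathrm{cov}(\mathcal M)=\mathfrak m(\mathbb C)$. (4) For duplication-allowed Mastermind with a finite number $n\ge 2$ of colors and with simplified or correctness-only feedback, the strategic mastermind number is equal to the corresponding mastermind number, and all four of these numbers are equal to the continuum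 $\mathfrak c$. (5) For incorrectness-only feedback, the strategic mastermind number is equal to $\mathfrak c$ in the duplication-allowed variant with countably infinitely many colors or with a finite number $n\ge2$ of colors, and also in the no-duplication variant with countably infinitely many colors. -/

import Mathlib

open scoped Cardinal Ordinal

namespace InfiniteMastermind

/-- Color sequences of length `ω` over the color set `C`, duplication of colors allowed. -/
def allWords (C : Type) : Set (ℕ → C) := Set.univ

/-- Color sequences of length `ω` over the color set `C` without duplication of colors. -/
def injWords (C : Type) : Set (ℕ → C) := {s | Function.Injective s}

section Feedback

variable {C : Type}

/-- The number (finite or infinite) of positions where the guessword `s` agrees with the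
codeword `w`. -/
noncomputable def correctCount (s w : ℕ → C) : ℕ∞ := {n | s n = w n}.encard

/-- The number (finite or infinite) of positions where the guessword `s` disagrees with the
codeword `w`. -/
noncomputable def incorrectCount (s w : ℕ → C) : ℕ∞ := {n | s n ≠ w n}.encard

/-- The rearrangement count: the largest number of pegs that become correct when the incorrect
pegs of the guessword `s` (and only these) are permuted among themselves. -/
noncomputable def rearrangementCount (s w : ℕ → C) : ℕ∞ :=
  ⨆ π : Equiv.Perm {n // s n ≠ w n}, {n : {n // s n ≠ w n} | s (π n) = w n}.encard

/-- The inherent error count: the smallest number of pegs that stay incorrect when the incorrect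
pegs of the guessword `s` (and only these) are permuted among themselves. -/
noncomputable def errorCount (s w : ℕ → C) : ℕ∞ :=
  ⨅ π : Equiv.Perm {n // s n ≠ w n}, {n : {n // s n ≠ w n} | s (π n) ≠ w n}.encard

/-- The Mastermind feedback `(κ, ρ, ε)` to the guessword `s` for the codeword `w`. -/
noncomputable def fullFeedback (s w : ℕ → C) : ℕ∞ × ℕ∞ × ℕ∞ :=
  (correctCount s w, rearrangementCount s w, errorCount s w)

/-- The feedback of simplified Mastermind: correctness and incorrectness count. -/
noncomputable def simplifiedFeedback (s w : ℕ → C) : ℕ∞ × ℕ∞ :=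
  (correctCount s w, incorrectCount s w)

end Feedback

section Game

/-! A variant of the game is given by the set `W` of allowed codewords and guesswords and by
the feedback `fb s w` to the guessword `s` for the codeword `w`. -/

variable {C R : Type}

/-- A set `S` of guesswords is winning if every codeword is uniquely determined by the feedback
to the guesswords in `S`. -/
def IsWinningSet (W : Set (ℕ → C)) (fb : (ℕ → C) → (ℕ → C) → R) (S : Set (ℕ → C)) : Prop :=
  S ⊆ W ∧ ∀ w ∈ W, ∀ w' ∈ W, (∀ s ∈ S, fb s w = fb s w') → w = w'

/-- The mastermind number of a variant: the smallest size of a winning set. -/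
noncomputable def mastermindNumber (W : Set (ℕ → C)) (fb : (ℕ → C) → (ℕ → C) → R) :
    Cardinal.{0} :=
  sInf {κ | ∃ S : Set (ℕ → C), IsWinningSet W fb S ∧ #S = κ}

/-- A strategy tells the codebreaker, at every ordinal stage `α`, which guessword to play on the
basis of the feedback received at the stages before `α`. -/
def Strategy (W : Set (ℕ → C)) (R : Type) : Type 1 :=
  ∀ α : Ordinal.{0}, (Set.Iio α → R) → W

/-- The guessword made at stage `α` when the codebreaker follows `σ` and the hidden codeword
is `w`. -/
noncomputable def play {W : Set (ℕ → C)} (fb : (ℕ → C) → (ℕ → C) → R) (σ : Strategy W R)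
    (w : ℕ → C) (α : Ordinal.{0}) : W :=
  σ α (fun β : Set.Iio α => fb (play fb σ w β.1).1 w)
termination_by α
decreasing_by exact β.2

/-- Whatever the codeword is, the strategy `σ` guesses it at some stage before `γ`. -/
def WinsBefore {W : Set (ℕ → C)} (fb : (ℕ → C) → (ℕ → C) → R) (σ : Strategy W R)
    (γ : Ordinal.{0}) : Prop :=
  ∀ w ∈ W, ∃ α < γ, (play fb σ w α : ℕ → C) = w

/-- The strategic mastermind number of a variant: the least ordinal `γ` such that the codebreaker
has a strategy always winning before stage `γ`. -/
noncomputable def strategicNumber (W : Set (ℕ → C)) (fb : (ℕ → C) → (ℕ → C) → R) :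
    Ordinal.{0} :=
  sInf {γ | ∃ σ : Strategy W R, WinsBefore fb σ γ}

end Game

/-- The covering number of the meager ideal: the smallest size of a family of meager sets that
covers Baire space. -/
noncomputable def covMeager : Cardinal.{0} :=
  sInf {κ | ∃ A : Set (Set (ℕ → ℕ)), (∀ M ∈ A, IsMeagre M) ∧ ⋃₀ A = Set.univ ∧ #A = κ}

/-- A subset `D` of a forcing notion is dense if every condition has an extension in `D`. -/
def IsDenseSubset {P : Type} [Preorder P] (D : Set P) : Prop := ∀ p, ∃ q ∈ D, q ≤ p

/-- The Martin number of a forcing notion: the smallest size of a family of dense sets for which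
no filter meets every member of the family. -/
noncomputable def martinNumber (P : Type) [Preorder P] : Cardinal.{0} :=
  sInf {κ | ∃ A : Set (Set P), (∀ D ∈ A, IsDenseSubset D) ∧
    (¬ ∃ G : Order.PFilter P, ∀ D ∈ A, ∃ p ∈ D, p ∈ G) ∧ #A = κ}

/-- A condition of Cohen forcing, viewed as adding a function `ℕ → ℕ`: a finite sequence, to be
an initial segment of the generic function. -/
structure CohenCondition : Type where
  stem : List ℕ

/-- The stronger conditions are the longer sequences. -/
instance : Preorder CohenCondition where
  le q p := p.stem <+: q.stem
  le_refl p := List.prefix_refl p.stem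
  le_trans _ _ _ h h' := h'.trans h

end InfiniteMastermind

namespace InfiniteMastermind

section Ordinals

/-- A type of size at most `κ` can be enumerated in order type `κ`, with repetitions. -/
theorem exists_ordinal_enumeration {T : Type} [Nonempty T] {κ : Cardinal.{0}} (h : #T ≤ κ) :
    ∃ e : Ordinal.{0} → T, ∀ t, ∃ α < κ.ord, e α = t := by
  have h1 : Cardinal.lift.{1} #T ≤ Cardinal.lift.{0} #(Set.Iio κ.ord) := by
    rw [Cardinal.mk_Iio_ordinal, Cardinal.card_ord, Cardinal.lift_id'.{0, 1}]
    exact Cardinal.lift_le.2 h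
  obtain ⟨f⟩ := Cardinal.lift_mk_le'.1 h1
  have hinj : Function.Injective fun t => (f t).1 :=
    Subtype.val_injective.comp f.injective
  exact ⟨Function.invFun fun t => (f t).1,
    fun t => ⟨(f t).1, (f t).2, Function.leftInverse_invFun hinj t⟩⟩

theorem mk_image_Iio_lt {T : Type} {κ : Cardinal.{0}} {γ : Ordinal.{0}} (hγ : γ < κ.ord)
    (f : Ordinal.{0} → T) : #(f '' Set.Iio γ) < κ := by
  have h := Cardinal.mk_image_le_lift (f := f) (s := Set.Iio γ)
  rw [Cardinal.mk_Iio_ordinal, Cardinal.lift_id'.{0, 1}] at h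
  exact (Cardinal.lift_le.1 h).trans_lt (Cardinal.lt_ord.1 hγ)

end Ordinals

section Game

variable {C R : Type} {W : Set (ℕ → C)} {fb : (ℕ → C) → (ℕ → C) → R} {κ : Cardinal.{0}}

theorem play_eq (σ : Strategy W R) (w : ℕ → C) (α : Ordinal.{0}) :
    play fb σ w α = σ α (fun β : Set.Iio α => fb (play fb σ w β.1).1 w) := by
  rw [play]

theorem strategicNumber_le {σ : Strategy W R} {γ : Ordinal.{0}} (h : WinsBefore fb σ γ) :
    strategicNumber W fb ≤ γ :=
  csInf_le' ⟨σ, h⟩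

theorem strategicNumber_eq {σ : Strategy W R} {γ : Ordinal.{0}} (h : WinsBefore fb σ γ)
    (hle : ∀ (τ : Strategy W R) (δ : Ordinal.{0}), WinsBefore fb τ δ → γ ≤ δ) :
    strategicNumber W fb = γ :=
  le_antisymm (strategicNumber_le h) (le_csInf ⟨γ, σ, h⟩ fun δ ⟨τ, hτ⟩ => hle τ δ hτ)

/-- Every family of fewer than `κ` guesswords receives the constant feedback `r` for some codeword
outside of the family. -/
def HasGeneric (W : Set (ℕ → C)) (fb : (ℕ → C) → (ℕ → C) → R) (κ : Cardinal.{0}) (r : R) : Prop :=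
  ∀ S ⊆ W, #S < κ → ∃ w ∈ W, w ∉ S ∧ ∀ s ∈ S, fb s w = r

theorem HasGeneric.comp {R' : Type} {r : R} (h : HasGeneric W fb κ r) (φ : R → R')
    {fb' : (ℕ → C) → (ℕ → C) → R'} (hφ : ∀ s w, fb' s w = φ (fb s w)) :
    HasGeneric W fb' κ (φ r) := fun S hS hc =>
  let ⟨w, hw, hwS, hr⟩ := h S hS hc
  ⟨w, hw, hwS, fun s hs => by rw [hφ, hr s hs]⟩

theorem HasGeneric.le_mk_of_isWinningSet {r : R} (h : HasGeneric W fb κ r) (hκ : ℵ₀ ≤ κ)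
    {S : Set (ℕ → C)} (hS : IsWinningSet W fb S) : κ ≤ #S := by
  by_contra! hlt
  obtain ⟨w, hw, hwS, hr⟩ := h S hS.1 hlt
  obtain ⟨w', hw', hwS', hr'⟩ := h (insert w S) (Set.insert_subset hw hS.1)
    (Cardinal.mk_insert_le.trans_lt
      (Cardinal.add_lt_of_lt hκ hlt (Cardinal.one_lt_aleph0.trans_le hκ)))
  have := hS.2 w hw w' hw' fun s hs => by rw [hr s hs, hr' s (Set.mem_insert_of_mem _ hs)]
  exact hwS' (this ▸ Set.mem_insert _ _)

theorem HasGeneric.ord_le_of_winsBefore {r : R} (h : HasGeneric W fb κ r)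
    {σ : Strategy W R} {γ : Ordinal.{0}} (hσ : WinsBefore fb σ γ) : κ.ord ≤ γ := by
  by_contra! hlt
  obtain ⟨w, hw, hwS, hr⟩ := h ((fun α => (σ α fun _ => r : ℕ → C)) '' Set.Iio γ)
    (by rintro _ ⟨α, -, rfl⟩; exact (σ α _).2) (mk_image_Iio_lt hlt _)
  have key : ∀ α, α < γ → play fb σ w α = σ α fun _ => r := by
    intro α
    induction α using WellFoundedLT.induction with
    | ind α ih =>
      intro hα
      rw [play_eq]
      congr 1
      funext β
      rw [ih β.1 β.2 (β.2.trans hα)]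
      exact hr _ ⟨β.1, β.2.trans hα, rfl⟩
  obtain ⟨α, hα, hwin⟩ := hσ w hw
  rw [key α hα] at hwin
  exact hwS ⟨α, hα, hwin⟩

/-- Every codeword is determined by the feedback to the guesswords of one of the at most `κ`
countable sets `B i`. -/
structure IsBlockFamily (W : Set (ℕ → C)) (fb : (ℕ → C) → (ℕ → C) → R) (κ : Cardinal.{0})
    {ι : Type} (B : ι → Set (ℕ → C)) : Prop where
  subset : ∀ i, B i ⊆ W
  countable : ∀ i, (B i).Countable
  mk_le : #ι ≤ κ
  determines : ∀ w ∈ W, ∃ i, ∀ w' ∈ W, (∀ s ∈ B i, fb s w = fb s w') → w = w'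

theorem IsBlockFamily.comp {R' : Type} {fb' : (ℕ → C) → (ℕ → C) → R'} {ι : Type}
    {B : ι → Set (ℕ → C)} (h : IsBlockFamily W fb κ B) (φ : R' → R)
    (hφ : ∀ s w, fb s w = φ (fb' s w)) : IsBlockFamily W fb' κ B where
  subset := h.subset
  countable := h.countable
  mk_le := h.mk_le
  determines w hw :=
    let ⟨i, hi⟩ := h.determines w hw
    ⟨i, fun w' hw' hs => hi w' hw' fun s hsB => by rw [hφ, hφ, hs s hsB]⟩

theorem IsBlockFamily.exists_isWinningSet {ι : Type} {B : ι → Set (ℕ → C)}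
    (h : IsBlockFamily W fb κ B) (hκ : ℵ₀ ≤ κ) : ∃ S, IsWinningSet W fb S ∧ #S ≤ κ := by
  refine ⟨⋃ i, B i, ⟨Set.iUnion_subset h.subset, fun w hw w' hw' hs => ?_⟩, ?_⟩
  · obtain ⟨i, hi⟩ := h.determines w hw
    exact hi w' hw' fun s hsB => hs s (Set.mem_iUnion.2 ⟨i, hsB⟩)
  · refine (Cardinal.mk_iUnion_le B).trans ?_
    refine (mul_le_mul' h.mk_le (ciSup_le' fun i => (h.countable i).le_aleph0)).trans ?_
    exact (Cardinal.mul_aleph0_eq hκ).le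

theorem IsBlockFamily.exists_winsBefore {ι : Type} {B : ι → Set (ℕ → C)}
    (h : IsBlockFamily W fb κ B) (hκ : ℵ₀ < κ) (hW : W.Nonempty) :
    ∃ σ : Strategy W R, WinsBefore fb σ κ.ord := by
  classical
  obtain ⟨w₀, hw₀⟩ := hW
  obtain ⟨i₀, -⟩ := h.determines w₀ hw₀
  have : Nonempty ι := ⟨i₀⟩
  have hB : ∀ i, ∃ b : ℕ → W, ∀ s ∈ B i, ∃ n, (b n : ℕ → C) = s := by
    intro i
    have hsub : insert w₀ (B i) ⊆ W := Set.insert_subset hw₀ (h.subset i)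
    obtain ⟨b, hb⟩ := ((h.countable i).insert w₀).exists_eq_range ⟨w₀, Set.mem_insert _ _⟩
    refine ⟨fun n => ⟨b n, hsub (hb ▸ Set.mem_range_self n)⟩, fun s hs => ?_⟩
    have : s ∈ Set.range b := hb ▸ Set.mem_insert_of_mem _ hs
    exact this
  choose b hb using hB
  obtain ⟨e, he⟩ := exists_ordinal_enumeration h.mk_le
  let nominal : Ordinal.{0} → W := fun δ => b (e (δ / ω)) (Cardinal.toNat (δ % ω).card - 1)
  let consistent : ∀ α : Ordinal.{0}, (Set.Iio α → R) → W → Prop := fun α hist w =>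
    ∀ β : Set.Iio α, β.1 % ω ≠ 0 → fb (nominal β.1) w = hist β
  let σ : Strategy W R := fun α hist =>
    if α % ω ≠ 0 then nominal α
    else if hc : ∃ w, consistent α hist w then hc.choose else ⟨w₀, hw₀⟩
  have hplay : ∀ w α, α % ω ≠ 0 → play fb σ w α = nominal α := fun w α hα => by
    rw [play_eq]; exact if_pos hα
  refine ⟨σ, fun w hw => ?_⟩
  obtain ⟨i, hi⟩ := h.determines w hw
  obtain ⟨α, hα, rfl⟩ := he i
  have hlim : Order.IsSuccLimit κ.ord := Cardinal.isSuccLimit_ord hκ.le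
  have hω : (ω : Ordinal.{0}) < κ.ord := by rwa [Cardinal.lt_ord, Ordinal.card_omega0]
  have hstage : ω * Order.succ α < κ.ord :=
    Ordinal.isPrincipal_mul_ord hκ.le hω (hlim.succ_lt hα)
  refine ⟨ω * Order.succ α, hstage, ?_⟩
  have hmod : (ω * Order.succ α) % ω = 0 := Ordinal.mul_mod _ _
  rw [play_eq]
  have hc : ∃ v, consistent (ω * Order.succ α)
      (fun β : Set.Iio _ => fb (play fb σ w β.1).1 w) v :=
    ⟨⟨w, hw⟩, fun β hβ => by dsimp only; rw [hplay w _ hβ]⟩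
  have hσ : σ (ω * Order.succ α) (fun β : Set.Iio _ => fb (play fb σ w β.1).1 w) = hc.choose := by
    simp only [σ]
    rw [if_neg (not_not.2 hmod), dif_pos hc]
  rw [hσ]
  refine (hi _ hc.choose.2 fun s hs => ?_).symm
  obtain ⟨n, rfl⟩ := hb _ s hs
  have hn : ((n + 1 : ℕ) : Ordinal.{0}) < ω := Ordinal.natCast_lt_omega0 _
  set β : Ordinal.{0} := ω * α + ((n + 1 : ℕ) : Ordinal.{0}) with hβ
  have hβlt : β < ω * Order.succ α := by
    rw [Ordinal.mul_succ]; exact add_lt_add_right hn _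
  have hβmod : β % ω = ((n + 1 : ℕ) : Ordinal.{0}) := by
    rw [hβ, Ordinal.mul_add_mod_self, Ordinal.mod_eq_of_lt hn]
  have hβdiv : β / ω = α := by
    rw [hβ, Ordinal.mul_add_div _ Ordinal.omega0_ne_zero, Ordinal.div_eq_zero_of_lt hn, add_zero]
  have hnom : nominal β = b (e α) n := by
    simp only [nominal, hβdiv, hβmod, Ordinal.card_nat, Cardinal.toNat_natCast,
      Nat.add_sub_cancel]
  have hβ0 : β % ω ≠ 0 := by
    rw [hβmod]; exact_mod_cast Nat.succ_ne_zero n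
  have := hc.choose_spec ⟨β, hβlt⟩ hβ0
  dsimp only at this
  rw [hplay w β hβ0, hnom] at this
  exact this.symm

/-- If few guesswords leave a generic codeword and countable blocks of guesswords suffice to pin
down each codeword, then both mastermind numbers are determined. -/
theorem numbers_eq {ι : Type} {B : ι → Set (ℕ → C)} {r : R} (hκ : ℵ₀ < κ) (hW : W.Nonempty)
    (hgen : HasGeneric W fb κ r) (hB : IsBlockFamily W fb κ B) :
    strategicNumber W fb = κ.ord ∧ mastermindNumber W fb = κ := by
  constructor
  · obtain ⟨σ, hσ⟩ := hB.exists_winsBefore hκ hW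
    exact strategicNumber_eq hσ fun τ δ hτ => hgen.ord_le_of_winsBefore hτ
  · obtain ⟨S, hS, hSκ⟩ := hB.exists_isWinningSet hκ.le
    have hmem : #S ∈ {κ | ∃ S : Set (ℕ → C), IsWinningSet W fb S ∧ #S = κ} := ⟨S, hS, rfl⟩
    refine le_antisymm ((csInf_le' hmem).trans hSκ) (le_csInf ⟨_, hmem⟩ ?_)
    rintro _ ⟨T, hT, rfl⟩
    exact hgen.le_mk_of_isWinningSet hκ.le hT

theorem IsWinningSet.exists_winsBefore_omega0_add_one {S : Set (ℕ → C)}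
    (hS : IsWinningSet W fb S) (hc : S.Countable) (hW : W.Nonempty) :
    ∃ σ : Strategy W R, WinsBefore fb σ (ω + 1) := by
  classical
  obtain ⟨w₀, hw₀⟩ := hW
  have hsub : insert w₀ S ⊆ W := Set.insert_subset hw₀ hS.1
  obtain ⟨b, hb⟩ := (hc.insert w₀).exists_eq_range ⟨w₀, Set.mem_insert _ _⟩
  let nominal : Ordinal.{0} → W := fun δ =>
    ⟨b (Cardinal.toNat δ.card), hsub (hb ▸ Set.mem_range_self _)⟩
  let σ : Strategy W R := fun α hist =>
    if α < ω then nominal α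
    else if hc : ∃ w : W, ∀ β : Set.Iio α, β.1 < ω → fb (nominal β.1) w = hist β then hc.choose
      else ⟨w₀, hw₀⟩
  have hplay : ∀ w α, α < ω → play fb σ w α = nominal α := fun w α hα => by
    rw [play_eq]; exact if_pos hα
  refine ⟨σ, fun w hw => ⟨ω, Order.lt_add_one_iff.2 le_rfl, ?_⟩⟩
  rw [play_eq]
  have hc : ∃ v : W, ∀ β : Set.Iio ω, β.1 < ω →
      fb (nominal β.1) v = (fun β : Set.Iio _ => fb (play fb σ w β.1).1 w) β :=
    ⟨⟨w, hw⟩, fun β hβ => by dsimp only; rw [hplay w _ hβ]⟩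
  have hσ : σ ω (fun β : Set.Iio _ => fb (play fb σ w β.1).1 w) = hc.choose := by
    simp only [σ]
    rw [if_neg (lt_irrefl _), dif_pos hc]
  rw [hσ]
  refine (hS.2 _ hw _ hc.choose.2 fun s hs => ?_).symm
  obtain ⟨n, rfl⟩ : s ∈ Set.range b := hb ▸ Set.mem_insert_of_mem _ hs
  have hn : ((n : ℕ) : Ordinal.{0}) < ω := Ordinal.natCast_lt_omega0 _
  have := hc.choose_spec ⟨n, hn⟩ hn
  dsimp only at this
  rw [hplay w _ hn] at this
  simpa only [nominal, Ordinal.card_nat, Cardinal.toNat_natCast] using this.symm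

/-- With countably many possible answers, only countably many words are ever guessed at finite
stages. -/
theorem omega0_lt_of_winsBefore [Countable R] (hW : ¬ W.Countable) {σ : Strategy W R}
    {γ : Ordinal.{0}} (hσ : WinsBefore fb σ γ) : ω + 1 ≤ γ := by
  rw [← Order.succ_eq_add_one, Order.succ_le_iff]
  by_contra! hγ
  have hfin : ∀ α : Ordinal.{0}, α < ω → Countable (Set.Iio α → R) := by
    intro α hα
    have : Finite (Set.Iio α) := by
      obtain ⟨n, rfl⟩ := Ordinal.lt_omega0.1 hα
      rw [← Cardinal.lt_aleph0_iff_finite, Cardinal.mk_Iio_ordinal]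
      simp
    infer_instance
  apply hW
  have : W ⊆ ⋃ n : ℕ, Set.range fun hist => (σ n hist : ℕ → C) := by
    intro w hw
    obtain ⟨α, hα, h⟩ := hσ w hw
    obtain ⟨n, rfl⟩ := Ordinal.lt_omega0.1 (hα.trans_le hγ)
    rw [play_eq] at h
    exact Set.mem_iUnion.2 ⟨n, _, h⟩
  refine (Set.countable_iUnion fun n => ?_).mono this
  have := hfin n (Ordinal.natCast_lt_omega0 n)
  exact Set.countable_range _

end Game

section Category

open PiNat

theorem isNowhereDense_iff_cylinder {s : Set (ℕ → ℕ)} :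
    IsNowhereDense s ↔ ∀ x n, ∃ y ∈ cylinder x n, ∃ m, Disjoint (cylinder y m) s := by
  have hbasis := isTopologicalBasis_cylinders fun _ : ℕ => ℕ
  constructor
  · intro h x n
    have hx : ¬ cylinder x n ⊆ closure s := fun hsub => by
      have : x ∈ interior (closure s) :=
        interior_maximal hsub (isOpen_cylinder _ x n) (self_mem_cylinder x n)
      rw [h] at this
      exact this
    obtain ⟨y, hy, hys⟩ := Set.not_subset.1 hx
    obtain ⟨_, ⟨z, m, rfl⟩, hyz, hsub⟩ :=
      hbasis.exists_subset_of_mem_open hys isClosed_closure.isOpen_compl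
    refine ⟨y, hy, m, ?_⟩
    rw [mem_cylinder_iff_eq.1 hyz]
    exact Set.disjoint_left.2 fun u hu hus => hsub hu (subset_closure hus)
  · intro h
    refine Set.eq_empty_of_forall_notMem fun x hx => ?_
    obtain ⟨_, ⟨z, n, rfl⟩, hxz, hsub⟩ := hbasis.exists_subset_of_mem_open hx isOpen_interior
    obtain ⟨y, hy, m, hd⟩ := h z n
    obtain ⟨u, hu, hus⟩ := mem_closure_iff.1 (interior_subset (hsub hy)) _
      (isOpen_cylinder _ y m) (self_mem_cylinder y m)
    exact Set.disjoint_left.1 hd hu hus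

theorem exists_meagre_cover :
    ∃ A : Set (Set (ℕ → ℕ)), (∀ M ∈ A, IsMeagre M) ∧ ⋃₀ A = Set.univ ∧ #A = covMeager := by
  refine csInf_mem (s := {κ | ∃ A : Set (Set (ℕ → ℕ)),
    (∀ M ∈ A, IsMeagre M) ∧ ⋃₀ A = Set.univ ∧ #A = κ})
    ⟨_, Set.range fun x : ℕ → ℕ => {x}, ?_, ?_, rfl⟩
  · rintro _ ⟨x, rfl⟩
    refine (isNowhereDense_iff_cylinder.2 fun y n => ?_).isMeagre
    refine ⟨Function.update y n (x n + 1), fun i hi => Function.update_of_ne hi.ne _ _, n + 1,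
      Set.disjoint_singleton_right.2 fun h => ?_⟩
    have := h n n.lt_succ_self
    simp at this
  · exact Set.eq_univ_of_forall fun x => ⟨{x}, ⟨x, rfl⟩, rfl⟩

theorem aleph0_lt_covMeager : ℵ₀ < covMeager := by
  by_contra! h
  obtain ⟨A, hA, hU, hc⟩ := exists_meagre_cover
  have hcount : A.Countable := Cardinal.le_aleph0_iff_set_countable.1 (hc.le.trans h)
  refine not_isMeagre_of_isOpen (X := ℕ → ℕ) isOpen_univ Set.univ_nonempty ?_
  rw [← hU, Set.sUnion_eq_biUnion]
  exact isMeagre_biUnion hcount hA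

theorem exists_notMem_of_isNowhereDense {ι : Type} (hι : #ι < covMeager)
    {M : ι → Set (ℕ → ℕ)} (hM : ∀ i, IsNowhereDense (M i)) : ∃ x, ∀ i, x ∉ M i := by
  by_contra! h
  refine (lt_of_le_of_lt (Cardinal.mk_range_le (f := M)) hι).not_ge
    (csInf_le' ⟨Set.range M, ?_, ?_, rfl⟩)
  · rintro _ ⟨i, rfl⟩
    exact (hM i).isMeagre
  · exact Set.eq_univ_of_forall fun x => let ⟨i, hi⟩ := h x; ⟨M i, ⟨i, rfl⟩, hi⟩

open Classical in
/-- The descending sequence of conditions whose member at `n + 1` is number `x n` in the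
enumeration `e`, if that extends the member at `n`. -/
noncomputable def descent {P : Type} [Preorder P] (e : ℕ → P) (x : ℕ → ℕ) : ℕ → P
  | 0 => e 0
  | n + 1 => if e (x n) ≤ descent e x n then e (x n) else descent e x n

theorem descent_antitone {P : Type} [Preorder P] (e : ℕ → P) (x : ℕ → ℕ) :
    Antitone (descent e x) := by
  refine antitone_nat_of_succ_le fun n => ?_
  rw [descent]
  split_ifs with h
  · exact h
  · exact le_rfl

theorem descent_congr {P : Type} [Preorder P] (e : ℕ → P) {x y : ℕ → ℕ} {n : ℕ}
    (h : ∀ i < n, x i = y i) : descent e x n = descent e y n := by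
  induction n with
  | zero => rfl
  | succ n ih => rw [descent, descent, ih fun i hi => h i (hi.trans n.lt_succ_self),
      h n n.lt_succ_self]

/-- Fewer than `cov(M)` dense sets of a countable forcing notion are met by a single descending
sequence. -/
theorem exists_antitone_of_lt_covMeager {P : Type} [Preorder P] [Countable P] [Nonempty P]
    {ι : Type} (D : ι → Set P) (hD : ∀ i, IsDenseSubset (D i)) (hι : #ι < covMeager) :
    ∃ p : ℕ → P, Antitone p ∧ ∀ i, ∃ n, p n ∈ D i := by
  obtain ⟨e, he⟩ := exists_surjective_nat P
  obtain ⟨x, hx⟩ := exists_notMem_of_isNowhereDense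
    (M := fun i => {x | ∀ n, descent e x n ∉ D i}) hι fun i => by
      refine isNowhereDense_iff_cylinder.2 fun x n => ?_
      obtain ⟨q, hq, hle⟩ := hD i (descent e x n)
      obtain ⟨k, rfl⟩ := he q
      refine ⟨Function.update x n k, fun j hj => Function.update_of_ne hj.ne _ _, n + 1,
        Set.disjoint_left.2 fun y hy hyM => hyM (n + 1) ?_⟩
      have hyx : descent e y n = descent e x n := descent_congr e fun j hj => by
        rw [hy j (hj.trans n.lt_succ_self), Function.update_of_ne hj.ne]
      have hyn : y n = k := by rw [hy n n.lt_succ_self, Function.update_self]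
      rw [descent, hyx, hyn, if_pos hle]
      exact hq
  refine ⟨descent e x, descent_antitone e x, fun i => ?_⟩
  simpa using hx i

end Category

section Martin

theorem exists_pfilter_of_antitone {P : Type} [Preorder P] {A : Set (Set P)} {p : ℕ → P}
    (hp : Antitone p) (h : ∀ D ∈ A, ∃ n, ∃ q ∈ D, p n ≤ q) :
    ∃ G : Order.PFilter P, ∀ D ∈ A, ∃ q ∈ D, q ∈ G := by
  have hG : Order.IsPFilter {q | ∃ n, p n ≤ q} := Order.IsPFilter.of_def ⟨p 0, 0, le_rfl⟩
    (by
      rintro a ⟨m, hm⟩ b ⟨n, hn⟩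
      exact ⟨p (max m n), ⟨_, le_rfl⟩, (hp (le_max_left _ _)).trans hm,
        (hp (le_max_right _ _)).trans hn⟩)
    (fun hxy ⟨n, hn⟩ => ⟨n, hn.trans hxy⟩)
  refine ⟨hG.toPFilter, fun D hD => ?_⟩
  obtain ⟨n, q, hq, hle⟩ := h D hD
  exact ⟨q, hq, n, hle⟩

theorem cohenCondition_stem_injective : Function.Injective CohenCondition.stem := by
  rintro ⟨_⟩ ⟨_⟩ rfl
  rfl

instance : Countable CohenCondition := cohenCondition_stem_injective.countable

instance : Nonempty CohenCondition := ⟨⟨[]⟩⟩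

/-- A family of at most `cov(M)` dense sets of Cohen conditions that no filter meets. -/
theorem exists_cohen_family_le_covMeager : ∃ A : Set (Set CohenCondition),
    (∀ D ∈ A, IsDenseSubset D) ∧ (¬ ∃ G : Order.PFilter CohenCondition, ∀ D ∈ A, ∃ p ∈ D, p ∈ G) ∧
      #A ≤ covMeager := by
  obtain ⟨A, hA, hU, hc⟩ := exists_meagre_cover
  have hN : ∀ M : A, ∃ N : ℕ → Set (ℕ → ℕ),
      (∀ k, IsNowhereDense (N k)) ∧ (M : Set _) ⊆ ⋃ k, N k := by
    rintro ⟨M, hM⟩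
    obtain ⟨S, hS, hSc, hsub⟩ := isMeagre_iff_countable_union_isNowhereDense.1 (hA M hM)
    obtain ⟨N, hN⟩ := (hSc.insert ∅).exists_eq_range ⟨∅, Set.mem_insert _ _⟩
    refine ⟨N, fun k => ?_, fun x hx => ?_⟩
    · have : N k ∈ insert ∅ S := hN ▸ Set.mem_range_self k
      rcases this with h | h
      · rw [h]; exact isNowhereDense_empty
      · exact hS _ h
    · obtain ⟨t, ht, hxt⟩ := hsub hx
      obtain ⟨k, rfl⟩ : t ∈ Set.range N := hN ▸ Set.mem_insert_of_mem _ ht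
      exact Set.mem_iUnion.2 ⟨k, hxt⟩
  choose N hNd hNM using hN
  let E : (A × ℕ) ⊕ ℕ → Set CohenCondition := Sum.elim
    (fun a => {p | ∀ x : ℕ → ℕ, (∀ i (h : i < p.stem.length), p.stem[i] = x i) → x ∉ N a.1 a.2})
    (fun n => {p | n < p.stem.length})
  refine ⟨Set.range E, ?_, ?_, ?_⟩
  · rintro _ ⟨a | n, rfl⟩ ⟨l⟩
    · obtain ⟨y, hy, m, hd⟩ := isNowhereDense_iff_cylinder.1 (hNd a.1 a.2)
        (fun i => l.getD i 0) l.length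
      refine ⟨⟨(List.range (max l.length m)).map y⟩, fun x hx hxN => ?_, ?_⟩
      · refine Set.disjoint_left.1 hd (fun i hi => ?_) hxN
        have := hx i (by simp; omega)
        simpa using this.symm
      · rw [PiNat.mem_cylinder_iff] at hy
        refine List.prefix_iff_getElem.2 ⟨by simp, fun i hi => ?_⟩
        have := hy i hi
        simp [this, hi]
    · exact ⟨⟨l ++ List.replicate (n + 1) 0⟩, by simp [E]; omega, List.prefix_append _ _⟩
  · rintro ⟨G, hG⟩
    have hlen : ∀ n, ∃ p : CohenCondition, p ∈ G ∧ n < p.stem.length := fun n =>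
      let ⟨p, hp, hpG⟩ := hG _ ⟨Sum.inr n, rfl⟩
      ⟨p, hpG, hp⟩
    choose p hpG hp using hlen
    let x : ℕ → ℕ := fun n => (p n).stem[n]'(hp n)
    have hx : ∀ q ∈ G, ∀ i (h : i < q.stem.length), q.stem[i] = x i := by
      intro q hq i hi
      obtain ⟨r, -, hrq, hrp⟩ := G.directed q hq (p i) (hpG i)
      change q.stem <+: r.stem at hrq
      change (p i).stem <+: r.stem at hrp
      exact (hrq.getElem hi).trans (hrp.getElem (hp i)).symm
    obtain ⟨M, hM, hxM⟩ : x ∈ ⋃₀ A := hU ▸ Set.mem_univ x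
    obtain ⟨k, hk⟩ := Set.mem_iUnion.1 (hNM ⟨M, hM⟩ hxM)
    obtain ⟨q, hqE, hqG⟩ := hG _ ⟨Sum.inl (⟨M, hM⟩, k), rfl⟩
    exact hqE x (hx q hqG) hk
  · refine Cardinal.mk_range_le.trans ?_
    rw [Cardinal.mk_sum, Cardinal.mk_prod, hc]
    simp only [Cardinal.mk_nat, Cardinal.lift_id]
    rw [Cardinal.mul_aleph0_eq aleph0_lt_covMeager.le]
    exact Cardinal.add_le_of_le aleph0_lt_covMeager.le le_rfl aleph0_lt_covMeager.le

theorem covMeager_eq_martinNumber : covMeager = martinNumber CohenCondition := by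
  obtain ⟨A, hA, hG, hc⟩ := exists_cohen_family_le_covMeager
  have hmem : #A ∈ {κ | ∃ A : Set (Set CohenCondition), (∀ D ∈ A, IsDenseSubset D) ∧
      (¬ ∃ G : Order.PFilter CohenCondition, ∀ D ∈ A, ∃ p ∈ D, p ∈ G) ∧ #A = κ} :=
    ⟨A, hA, hG, rfl⟩
  refine le_antisymm (le_csInf ⟨_, hmem⟩ ?_) ((csInf_le' hmem).trans hc)
  rintro _ ⟨A', hA', hG', rfl⟩
  by_contra! hlt
  obtain ⟨p, hp, hpD⟩ := exists_antitone_of_lt_covMeager (fun D : A' => (D : Set CohenCondition))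
    (fun D => hA' D D.2) hlt
  exact hG' (exists_pfilter_of_antitone hp fun D hD =>
    let ⟨n, hn⟩ := hpD ⟨D, hD⟩
    ⟨n, p n, hn, le_rfl⟩)

end Martin

section EventuallyDifferent

open Filter

/-- For every family of at most `κ` functions some function agrees with each of them infinitely
often. -/
def HasInfinitelyOftenEqual (κ : Cardinal.{0}) : Prop :=
  ∀ F : Set (ℕ → ℕ), #F ≤ κ → ∃ g : ℕ → ℕ, ∀ f ∈ F, ∃ᶠ n in atTop, f n = g n

variable {κ : Cardinal.{0}} {ι : Type}

theorem HasInfinitelyOftenEqual.exists_frequently_eq (h : HasInfinitelyOftenEqual κ)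
    (hι : #ι ≤ κ) {β : Type} [Countable β] [Nonempty β] (f : ι → ℕ → β) :
    ∃ g : ℕ → β, ∀ i, ∃ᶠ n in atTop, f i n = g n := by
  obtain ⟨c, hc⟩ := exists_injective_nat β
  obtain ⟨g, hg⟩ := h (Set.range fun i n => c (f i n)) (Cardinal.mk_range_le.trans hι)
  refine ⟨fun n => Function.invFun c (g n), fun i => (hg _ ⟨i, rfl⟩).mono fun n hn => ?_⟩
  dsimp only at hn ⊢
  rw [← hn, Function.leftInverse_invFun hc]

open Classical in
theorem HasInfinitelyOftenEqual.exists_eq_mem (h : HasInfinitelyOftenEqual κ)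
    (hι : #ι ≤ κ) {β : Type} [Countable β] [Nonempty β] (f : ι → ℕ → β) (X : ι → Set ℕ)
    (hX : ∀ i, (X i).Infinite) : ∃ g : ℕ → β, ∀ i, ∃ n ∈ X i, f i n = g n := by
  choose Y hYX hYc using fun i n => (hX i).exists_subset_card_eq (n + 1)
  obtain ⟨G, hG⟩ := h.exists_frequently_eq hι
    (fun i n => (Y i n).image fun x => (x, f i x))
  let t : ℕ → Finset ℕ := fun n =>
    if n + 1 ≤ ((G n).image Prod.fst).card then (G n).image Prod.fst else Finset.range (n + 1)
  have ht : ∀ n, n + 1 ≤ (t n).card := fun n => by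
    simp only [t]
    split_ifs with hn
    · exact hn
    · simp
  obtain ⟨z, hz, hzt⟩ := (Finset.all_card_le_biUnion_card_iff_exists_injective t).1 fun s => by
    rcases s.eq_empty_or_nonempty with rfl | hs
    · simp
    · calc s.card ≤ (Finset.range (s.max' hs + 1)).card := Finset.card_le_card fun x hx =>
            Finset.mem_range.2 (Nat.lt_succ_of_le (s.le_max' x hx))
        _ = s.max' hs + 1 := Finset.card_range _
        _ ≤ (t (s.max' hs)).card := ht _
        _ ≤ (s.biUnion t).card := Finset.card_le_card
            (Finset.subset_biUnion_of_mem t (s.max'_mem hs))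
  refine ⟨fun x => if hx : ∃ y, (x, y) ∈ G (Function.invFun z x) then hx.choose
    else Classical.arbitrary β, fun i => ?_⟩
  obtain ⟨n, hn⟩ := (hG i).exists
  have himg : (G n).image Prod.fst = Y i n := by
    rw [← hn, Finset.image_image]
    exact Finset.image_id
  have hzn : z n ∈ Y i n := by
    have := hzt n
    simp only [t, himg, hYc, le_refl, if_true] at this
    exact this
  refine ⟨z n, hYX i n hzn, ?_⟩
  have hinv : Function.invFun z (z n) = n := Function.leftInverse_invFun hz n
  have hex : ∃ y, (z n, y) ∈ G (Function.invFun z (z n)) := by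
    rw [hinv, ← hn]
    exact ⟨_, Finset.mem_image_of_mem _ hzn⟩
  dsimp only
  rw [dif_pos hex]
  have := hex.choose_spec
  generalize hex.choose = y at this ⊢
  rw [hinv, ← hn] at this
  obtain ⟨x, -, hx⟩ := Finset.mem_image.1 this
  rw [Prod.mk.injEq] at hx
  rw [← hx.2, hx.1]

theorem HasInfinitelyOftenEqual.exists_monotone (h : HasInfinitelyOftenEqual κ) (hκ : ℵ₀ ≤ κ)
    (hι : #ι ≤ κ) (f : ι → ℕ → ℕ) (hf : ∀ i, Monotone (f i)) :
    ∃ j : ℕ → ℕ, Monotone j ∧ ∀ i, ∃ᶠ n in atTop, f i (j n) ≤ j (n + 1) := by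
  have hι' : #(ι × ℕ × ℕ) ≤ κ := by
    rw [Cardinal.mk_prod, Cardinal.lift_id, Cardinal.lift_id]
    exact (mul_le_mul' hι Cardinal.mk_le_aleph0).trans (Cardinal.mul_aleph0_eq hκ).le
  obtain ⟨g, hg⟩ := h.exists_frequently_eq hι' fun a n => (f a.1)^[n - a.2.1] a.2.2 + 1
  refine ⟨fun n => ∑ m ∈ Finset.range (n + 1), g m, fun m n hmn =>
    Finset.sum_le_sum_of_subset (Finset.range_mono (by omega)), fun i hi => ?_⟩
  simp only [not_le] at hi
  obtain ⟨N, hN⟩ := eventually_atTop.1 hi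
  set j : ℕ → ℕ := fun n => ∑ m ∈ Finset.range (n + 1), g m with hj
  have hle : ∀ k, j (N + k) ≤ (f i)^[k] (j N) := by
    intro k
    induction k with
    | zero => exact le_rfl
    | succ k ih =>
      rw [Function.iterate_succ_apply']
      exact (hN (N + k) (by omega)).le.trans (hf i ih)
  obtain ⟨n, hn, hgn⟩ := frequently_atTop.1 (hg (i, N, j N)) N
  have h1 := hle (n - N)
  rw [Nat.add_sub_cancel' hn] at h1
  have h2 : g n ≤ j n := Finset.single_le_sum (f := g) (fun _ _ => Nat.zero_le _)
    (Finset.mem_range.2 n.lt_succ_self)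
  dsimp only at hgn
  omega

theorem exists_forall_append_mem {D : Set (List ℕ)} (hup : ∀ l ∈ D, ∀ t, l ++ t ∈ D)
    (hd : ∀ l, ∃ t, l ++ t ∈ D) (s : Finset (List ℕ)) : ∃ t, ∀ l ∈ s, l ++ t ∈ D := by
  classical
  induction s using Finset.induction with
  | empty => exact ⟨[], by simp⟩
  | insert a s ha ih =>
    obtain ⟨t, ht⟩ := ih
    obtain ⟨u, hu⟩ := hd (a ++ t)
    refine ⟨t ++ u, fun l hl => ?_⟩
    rw [← List.append_assoc]
    rcases Finset.mem_insert.1 hl with rfl | hl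
    · exact hu
    · exact hup _ (ht l hl) u

open Classical in
/-- If the `g n` are appended in turn as long as the code of the result stays below `j (n + 1)`,
these are the lists obtained. -/
noncomputable def boundedConcat (j : ℕ → ℕ) (g : ℕ → List ℕ) : ℕ → List ℕ
  | 0 => []
  | n + 1 => if Encodable.encode (boundedConcat j g n ++ g n) ≤ j (n + 1)
      then boundedConcat j g n ++ g n else boundedConcat j g n

theorem HasInfinitelyOftenEqual.exists_chain (h : HasInfinitelyOftenEqual κ) (hκ : ℵ₀ ≤ κ)
    (hι : #ι ≤ κ) (D : ι → Set (List ℕ)) (hup : ∀ i, ∀ l ∈ D i, ∀ t, l ++ t ∈ D i)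
    (hd : ∀ i l, ∃ t, l ++ t ∈ D i) :
    ∃ l : ℕ → List ℕ, (∀ n, l n <+: l (n + 1)) ∧ ∀ i, ∃ n, l n ∈ D i := by
  classical
  have hfin : ∀ n, {l : List ℕ | Encodable.encode l ≤ n}.Finite := fun n =>
    (Set.finite_Iic n).preimage Encodable.encode_injective.injOn
  have ht : ∀ i n, ∃ t : List ℕ, ∀ l : List ℕ, Encodable.encode l ≤ n → l ++ t ∈ D i := by
    intro i n
    obtain ⟨t, ht⟩ := exists_forall_append_mem (hup i) (hd i) (hfin n).toFinset
    exact ⟨t, fun l hl => ht l (by simpa using hl)⟩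
  choose t ht using ht
  let b : ι → ℕ → ℕ := fun i n =>
    (hfin n).toFinset.sup fun l => Encodable.encode (l ++ t i n)
  let f : ι → ℕ → ℕ := fun i n => ∑ m ∈ Finset.range (n + 1), b i m
  have hbf : ∀ i n l, Encodable.encode l ≤ n → Encodable.encode (l ++ t i n) ≤ f i n := by
    intro i n l hl
    refine le_trans ?_ (Finset.single_le_sum (f := b i) (fun _ _ => Nat.zero_le _)
      (Finset.mem_range.2 n.lt_succ_self))
    exact Finset.le_sup (f := fun l => Encodable.encode (l ++ t i n)) (by simpa using hl)
  obtain ⟨j, hj, hjf⟩ := h.exists_monotone hκ hι f fun i m n hmn =>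
    Finset.sum_le_sum_of_subset (Finset.range_mono (by omega))
  obtain ⟨g, hg⟩ := h.exists_eq_mem hι (fun i n => t i (j n))
    (fun i => {n | f i (j n) ≤ j (n + 1)}) fun i => Nat.frequently_atTop_iff_infinite.1 (hjf i)
  have hcode : ∀ n, Encodable.encode (boundedConcat j g n) ≤ j n := by
    intro n
    induction n with
    | zero => simp [boundedConcat]
    | succ n ih =>
      rw [boundedConcat]
      split_ifs with hle
      · exact hle
      · exact ih.trans (hj n.le_succ)
  refine ⟨boundedConcat j g, fun n => ?_, fun i => ?_⟩
  · rw [boundedConcat]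
    split_ifs
    · exact List.prefix_append _ _
    · exact List.prefix_refl _
  · obtain ⟨n, hn, hgn⟩ := hg i
    refine ⟨n + 1, ?_⟩
    rw [boundedConcat, ← hgn, if_pos ((hbf i _ _ (hcode n)).trans hn)]
    exact ht i _ _ (hcode n)

/-- Bartoszyński's theorem: some family of at most `cov(M)` functions contains, for every function,
one that is eventually different from it. -/
theorem exists_eventually_different_family : ∃ F : Set (ℕ → ℕ), #F ≤ covMeager ∧
    ∀ g : ℕ → ℕ, ∃ f ∈ F, ∀ᶠ n in atTop, f n ≠ g n := by
  by_contra! hno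
  have h : HasInfinitelyOftenEqual covMeager := fun F hF =>
    let ⟨g, hg⟩ := hno F hF
    ⟨g, fun f hf => by simpa [Filter.Frequently] using hg f hf⟩
  obtain ⟨A, hA, hG, hc⟩ := exists_cohen_family_le_covMeager
  obtain ⟨l, hl, hlD⟩ := h.exists_chain aleph0_lt_covMeager.le hc
    (fun D : A => {l | ∃ q ∈ (D : Set CohenCondition), q.stem <+: l})
    (fun D l ⟨q, hq, hql⟩ t => ⟨q, hq, hql.trans (List.prefix_append _ _)⟩)
    (fun D l => by
      obtain ⟨q, hq, t, ht⟩ := hA D D.2 ⟨l⟩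
      exact ⟨t, q, hq, by rw [ht]⟩)
  have hanti : Antitone fun n => (⟨l n⟩ : CohenCondition) := antitone_nat_of_succ_le hl
  exact hG (exists_pfilter_of_antitone hanti fun D hD =>
    let ⟨n, q, hq, hql⟩ := hlD ⟨D, hD⟩
    ⟨n, q, hq, hql⟩)

end EventuallyDifferent

open Filter

section Words

variable {C : Type}

theorem correctCount_eq_zero {s w : ℕ → C} : correctCount s w = 0 ↔ ∀ n, s n ≠ w n := by
  simp [correctCount, Set.eq_empty_iff_forall_notMem]

theorem incorrectCount_eq_zero {s w : ℕ → C} : incorrectCount s w = 0 ↔ s = w := by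
  simp [incorrectCount, Set.eq_empty_iff_forall_notMem, funext_iff]

theorem correctCount_eq_top {s w : ℕ → C} : correctCount s w = ⊤ ↔ ∃ᶠ n in atTop, s n = w n := by
  rw [correctCount, Set.encard_eq_top_iff, Nat.frequently_atTop_iff_infinite]

theorem incorrectCount_eq_top {s w : ℕ → C} :
    incorrectCount s w = ⊤ ↔ ∃ᶠ n in atTop, s n ≠ w n := by
  rw [incorrectCount, Set.encard_eq_top_iff, Nat.frequently_atTop_iff_infinite]

theorem ne_of_incorrectCount_eq_top {s w : ℕ → C} (h : incorrectCount s w = ⊤) : s ≠ w := by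
  intro hsw
  rw [incorrectCount_eq_zero.2 hsw] at h
  exact ENat.zero_ne_top h

theorem countable_eventuallyEq [Countable C] (f : ℕ → C) :
    {t : ℕ → C | t =ᶠ[atTop] f}.Countable := by
  have hsub : {t : ℕ → C | t =ᶠ[atTop] f} ⊆ ⋃ N : ℕ, {t | ∀ n ≥ N, t n = f n} := fun t ht =>
    let ⟨N, hN⟩ := eventually_atTop.1 ht
    Set.mem_iUnion.2 ⟨N, hN⟩
  refine (Set.countable_iUnion fun N => ?_).mono hsub
  refine Set.MapsTo.countable_of_injOn (f := fun (t : ℕ → C) (i : Fin N) => t i)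
    (Set.mapsTo_univ _ _) (fun t ht u hu htu => ?_) Set.countable_univ
  funext n
  rcases lt_or_ge n N with hn | hn
  · exact congrFun htu ⟨n, hn⟩
  · rw [ht n hn, hu n hn]

theorem mk_words_le_continuum [Countable C] (W : Set (ℕ → C)) : #W ≤ 𝔠 := by
  refine (Cardinal.mk_set_le W).trans ?_
  rw [← Cardinal.power_def, Cardinal.mk_nat, ← Cardinal.aleph0_power_aleph0]
  exact Cardinal.power_le_power_right Cardinal.mk_le_aleph0

theorem mk_boolSeq : #(ℕ → Bool) = 𝔠 := by
  rw [← Cardinal.power_def, Cardinal.mk_nat, Cardinal.mk_bool, Cardinal.two_power_aleph0]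

theorem continuum_le_mk_allWords [Nontrivial C] : 𝔠 ≤ #(allWords C) := by
  obtain ⟨a, b, hab⟩ := exists_pair_ne C
  rw [← mk_boolSeq]
  refine Cardinal.mk_le_of_injective (f := fun x => ⟨fun n => bif x n then a else b, trivial⟩)
    fun x y hxy => funext fun n => ?_
  have := congrFun (congrArg Subtype.val hxy) n
  dsimp only at this
  cases hx : x n <;> cases hy : y n <;> rw [hx, hy] at this
  · exact (hab this.symm).elim
  · exact (hab this).elim

theorem continuum_le_mk_injWords [Countable C] [Infinite C] : 𝔠 ≤ #(injWords C) := by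
  obtain ⟨e⟩ := nonempty_equiv_of_countable (α := ℕ × Bool) (β := C)
  rw [← mk_boolSeq]
  refine Cardinal.mk_le_of_injective (f := fun x => ⟨fun n => e (n, x n), fun m n hmn => ?_⟩)
    fun x y hxy => funext fun n => ?_
  · simpa using congrArg Prod.fst (e.injective hmn)
  · simpa using congrFun (congrArg Subtype.val hxy) n

theorem exists_notMem_of_mk_lt {ι T : Type} {κ : Cardinal.{0}} (hκ : ℵ₀ < κ) (hι : #ι < κ)
    {X : Set T} (hX : κ ≤ #X) (V : ι → Set T) (hV : ∀ i, (V i).Countable) :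
    ∃ x ∈ X, ∀ i, x ∉ V i := by
  by_contra! h
  have hsub : X ⊆ ⋃ i, V i := fun x hx => Set.mem_iUnion.2 (h x hx)
  refine ((Cardinal.mk_le_mk_of_subset hsub).trans (Cardinal.mk_iUnion_le V)).not_gt ?_
  refine lt_of_le_of_lt (mul_le_mul' le_rfl (ciSup_le' fun i => (hV i).le_aleph0)) ?_
  exact (Cardinal.mul_lt_of_lt hκ.le hι hκ).trans_le hX

theorem hasGeneric_incorrectCount [Countable C] {W : Set (ℕ → C)} (hW : 𝔠 ≤ #W) :
    HasGeneric W incorrectCount 𝔠 ⊤ := by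
  intro S _ hc
  obtain ⟨w, hw, hwS⟩ := exists_notMem_of_mk_lt Cardinal.aleph0_lt_continuum hc hW
    (fun s : S => {t | t =ᶠ[atTop] (s : ℕ → C)}) fun s => countable_eventuallyEq s.1
  have hfb : ∀ s ∈ S, incorrectCount s w = ⊤ := fun s hs => by
    rw [incorrectCount_eq_top]
    exact fun h => hwS ⟨s, hs⟩ (h.mono fun n hn => (not_not.1 hn).symm)
  exact ⟨w, hw, fun hwS => ne_of_incorrectCount_eq_top (hfb w hwS) rfl, hfb⟩

theorem isBlockFamily_incorrectCount [Countable C] (W : Set (ℕ → C)) :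
    IsBlockFamily W incorrectCount 𝔠 fun w : W => {(w : ℕ → C)} where
  subset w := Set.singleton_subset_iff.2 w.2
  countable _ := Set.countable_singleton _
  mk_le := mk_words_le_continuum W
  determines w hw := ⟨⟨w, hw⟩, fun _ _ h => incorrectCount_eq_zero.1 <|
    (h w rfl).symm.trans (incorrectCount_eq_zero.2 rfl)⟩

theorem isBlockFamily_allWords [Countable C] [Nontrivial C] {ι : Type} {κ : Cardinal.{0}}
    (hι : #ι ≤ κ) (f : ι → ℕ → C) (hf : ∀ w : ℕ → C, ∃ i, ∀ᶠ n in atTop, f i n ≠ w n) :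
    IsBlockFamily (allWords C) correctCount κ fun i => {t | t =ᶠ[atTop] f i} where
  subset i := Set.subset_univ _
  countable i := countable_eventuallyEq _
  mk_le := hι
  determines w _ := by
    classical
    obtain ⟨i, hi⟩ := hf w
    refine ⟨i, fun w' _ h => ?_⟩
    choose o ho using fun c : C => exists_ne c
    let s : ℕ → C := fun n => if f i n = w n then o (w n) else f i n
    have hsf : s =ᶠ[atTop] f i := hi.mono fun n hn => if_neg hn
    have hsw : ∀ n, s n ≠ w n := fun n => by
      by_cases hn : f i n = w n
      · simp only [s, if_pos hn]; exact ho _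
      · simpa only [s, if_neg hn] using hn
    have hsw' : ∀ n, s n ≠ w' n := correctCount_eq_zero.1 <|
      (h s hsf).symm.trans (correctCount_eq_zero.2 hsw)
    by_contra hne
    obtain ⟨n, hn⟩ := Function.ne_iff.1 hne
    have ht : Function.update s n (w n) =ᶠ[atTop] f i := by
      filter_upwards [hsf, eventually_gt_atTop n] with m hm hmn
      rw [Function.update_of_ne hmn.ne', hm]
    have h0 : correctCount (Function.update s n (w n)) w' = 0 := by
      refine correctCount_eq_zero.2 fun m => ?_
      rcases eq_or_ne m n with rfl | hmn
      · rwa [Function.update_self]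
      · rw [Function.update_of_ne hmn]; exact hsw' m
    exact correctCount_eq_zero.1 ((h _ ht).trans h0) n (Function.update_self ..)

theorem exists_injective_modification {s : ℕ → C} (hs : Function.Injective s)
    (hr : (Set.range s)ᶜ.Infinite) {E : Set ℕ} (hE : E.Finite) {B : Set C} (hB : B.Finite) :
    ∃ t : ℕ → C, Function.Injective t ∧ (Set.range t)ᶜ.Infinite ∧ (∀ n ∉ E, t n = s n) ∧
      ∀ n ∈ E, t n ∉ B ∧ t n ∉ Set.range s := by
  classical
  have hinf := hr.sdiff hB
  let g := hinf.natEmbedding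
  have hg : ∀ n, (g n : C) ∉ Set.range s ∧ (g n : C) ∉ B := fun n => (g n).2
  refine ⟨fun n => if n ∈ E then g n else s n, fun m n hmn => ?_, ?_, fun n hn => if_neg hn,
    fun n hn => ?_⟩
  · dsimp only at hmn
    split_ifs at hmn with h1 h2 h2
    · exact g.injective (Subtype.ext hmn)
    · exact ((hg m).1 ⟨n, hmn.symm⟩).elim
    · exact ((hg n).1 ⟨m, hmn⟩).elim
    · exact hs hmn
  · refine (hr.sdiff (hE.image fun n => (g n : C))).mono ?_
    rintro c ⟨hc, hcE⟩ ⟨n, rfl⟩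
    dsimp only at hc hcE
    split_ifs at hc hcE with h
    · exact hcE ⟨n, h, rfl⟩
    · exact hc ⟨n, rfl⟩
  · dsimp only
    rw [if_pos hn]
    exact (hg n).symm

theorem isBlockFamily_injWords [Countable C] {ι : Type} {κ : Cardinal.{0}}
    (hι : #ι ≤ κ) (f : ι → ℕ → C) (hinj : ∀ i, Function.Injective (f i))
    (hr : ∀ i, (Set.range (f i))ᶜ.Infinite) (hf : ∀ w : ℕ → C, ∃ i, ∀ᶠ n in atTop, f i n ≠ w n) :
    IsBlockFamily (injWords C) correctCount κ
      fun i => {t | Function.Injective t ∧ t =ᶠ[atTop] f i} where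
  subset i t ht := ht.1
  countable i := (countable_eventuallyEq (f i)).mono fun t ht => ht.2
  mk_le := hι
  determines w _ := by
    classical
    obtain ⟨i, hi⟩ := hf w
    refine ⟨i, fun w' _ h => ?_⟩
    have hE : {n | f i n = w n}.Finite := by
      by_contra hinf
      exact Nat.frequently_atTop_iff_infinite.2 hinf hi
    obtain ⟨s, hs, hsr, hsE, hsB⟩ := exists_injective_modification (hinj i) (hr i) hE
      (hE.image w)
    have hsf : s =ᶠ[atTop] f i := hi.mono fun n hn => hsE n hn
    have hsw : ∀ n, s n ≠ w n := fun n hn => by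
      by_cases hnE : f i n = w n
      · exact (hsB n hnE).1 ⟨n, hnE, hn.symm⟩
      · rw [hsE n hnE] at hn
        exact hnE hn
    have hsw' : ∀ n, s n ≠ w' n := correctCount_eq_zero.1 <|
      (h s ⟨hs, hsf⟩).symm.trans (correctCount_eq_zero.2 hsw)
    by_contra hne
    obtain ⟨n, hn⟩ := Function.ne_iff.1 hne
    have hE' : {m | s m = w n}.Finite :=
      Set.Subsingleton.finite fun a ha b hb => hs (ha.trans hb.symm)
    obtain ⟨t, ht, -, htE, htB⟩ := exists_injective_modification hs hsr hE'
      ((hE'.image w').insert (w n))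
    have htn : ∀ m, t m ≠ w n := fun m hm => by
      by_cases hmE : s m = w n
      · exact (htB m hmE).1 (Or.inl hm)
      · rw [htE m hmE] at hm
        exact hmE hm
    have htw' : ∀ m, t m ≠ w' m := fun m hm => by
      by_cases hmE : s m = w n
      · exact (htB m hmE).1 (Or.inr ⟨m, hmE, hm.symm⟩)
      · rw [htE m hmE] at hm
        exact hsw' m hm
    have hu : Function.Injective (Function.update t n (w n)) := by
      intro a b hab
      simp only [Function.update_apply] at hab
      split_ifs at hab with h1 h2 h2
      · rw [h1, h2]
      · exact (htn b hab.symm).elim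
      · exact (htn a hab).elim
      · exact ht hab
    have huf : Function.update t n (w n) =ᶠ[atTop] f i := by
      have hEev : ∀ᶠ m in atTop, s m ≠ w n := by
        rw [← Nat.cofinite_eq_atTop]
        exact hE'.eventually_cofinite_notMem
      filter_upwards [hsf, eventually_gt_atTop n, hEev] with m hm hmn hmE
      rw [Function.update_of_ne hmn.ne', htE m hmE, hm]
    have h0 : correctCount (Function.update t n (w n)) w' = 0 := by
      refine correctCount_eq_zero.2 fun m => ?_
      rcases eq_or_ne m n with rfl | hmn
      · rwa [Function.update_self]
      · rw [Function.update_of_ne hmn]; exact htw' m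
    exact correctCount_eq_zero.1 ((h _ ⟨hu, huf⟩).trans h0) n (Function.update_self ..)

end Words

section EventuallyDifferentWords

variable (C : Type) [Countable C] [Infinite C]

theorem exists_isBlockFamily_allWords : ∃ (ι : Type) (B : ι → Set (ℕ → C)),
    IsBlockFamily (allWords C) correctCount covMeager B := by
  obtain ⟨F, hF, hd⟩ := exists_eventually_different_family
  obtain ⟨e⟩ := nonempty_equiv_of_countable (α := ℕ) (β := C)
  refine ⟨F, _, isBlockFamily_allWords hF (fun f n => e (f.1 n)) fun w => ?_⟩
  obtain ⟨f, hf, hfw⟩ := hd (e.symm ∘ w)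
  exact ⟨⟨f, hf⟩, hfw.mono fun n hn h => hn (by simp [← h])⟩

theorem exists_isBlockFamily_injWords : ∃ (ι : Type) (B : ι → Set (ℕ → C)),
    IsBlockFamily (injWords C) correctCount covMeager B := by
  obtain ⟨F, hF, hd⟩ := exists_eventually_different_family
  obtain ⟨e⟩ := nonempty_equiv_of_countable (α := ℕ × ℕ × Bool) (β := C)
  refine ⟨F, _, isBlockFamily_injWords hF (fun f n => e (n, f.1 n, true)) (fun f m n hmn => ?_)
    (fun f => ?_) fun w => ?_⟩
  · simpa using congrArg Prod.fst (e.injective hmn)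
  · refine (Set.infinite_range_of_injective (f := fun n : ℕ => e (n, 0, false))
      fun m n hmn => by simpa using hmn).mono ?_
    rintro _ ⟨n, rfl⟩ ⟨m, hm⟩
    simp at hm
  · obtain ⟨f, hf, hfw⟩ := hd fun n => (e.symm (w n)).2.1
    exact ⟨⟨f, hf⟩, hfw.mono fun n hn h => hn (by simp [← h])⟩

end EventuallyDifferentWords

section GenericWords

theorem mk_prod_countable_lt {ι T : Type} [Countable T] {κ : Cardinal.{0}} (hκ : ℵ₀ < κ)
    (hι : #ι < κ) : #(ι × T) < κ := by
  rw [Cardinal.mk_prod, Cardinal.lift_id, Cardinal.lift_id]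
  exact Cardinal.mul_lt_of_lt hκ.le hι (Cardinal.mk_le_aleph0.trans_lt hκ)

theorem isNowhereDense_forall_ge {Q : ℕ → ℕ → Prop} (hQ : ∀ n, ∃ c, ¬ Q n c) (N : ℕ) :
    IsNowhereDense {x : ℕ → ℕ | ∀ n ≥ N, Q n (x n)} := by
  refine isNowhereDense_iff_cylinder.2 fun x n => ?_
  obtain ⟨c, hc⟩ := hQ (max n N)
  refine ⟨Function.update x (max n N) c, fun i hi => Function.update_of_ne ?_ _ _, max n N + 1,
    Set.disjoint_left.2 fun y hy hyQ => hc ?_⟩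
  · exact (hi.trans_le (le_max_left _ _)).ne
  · have := hyQ (max n N) (le_max_right _ _)
    rwa [hy _ (Nat.lt_succ_self _), Function.update_self] at this

theorem hasGeneric_allWords (C : Type) [Countable C] [Nontrivial C] :
    HasGeneric (allWords C) simplifiedFeedback covMeager (⊤, ⊤) := by
  intro S _ hc
  obtain ⟨e, he⟩ := exists_surjective_nat C
  let M : S × ℕ × Bool → Set (ℕ → ℕ) := fun a =>
    {x | ∀ n ≥ a.2.1, bif a.2.2 then a.1.1 n ≠ e (x n) else a.1.1 n = e (x n)}
  obtain ⟨x, hx⟩ := exists_notMem_of_isNowhereDense (M := M)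
    (mk_prod_countable_lt aleph0_lt_covMeager hc) (by
      rintro ⟨s, N, _ | _⟩
      · refine isNowhereDense_forall_ge (Q := fun n c => s.1 n = e c) (fun n => ?_) N
        obtain ⟨c, hc⟩ := exists_ne (s.1 n)
        obtain ⟨k, rfl⟩ := he c
        exact ⟨k, hc.symm⟩
      · refine isNowhereDense_forall_ge (Q := fun n c => s.1 n ≠ e c) (fun n => ?_) N
        obtain ⟨k, hk⟩ := he (s.1 n)
        exact ⟨k, not_not.2 hk.symm⟩)
  have h1 : ∀ s ∈ S, correctCount s (e ∘ x) = ⊤ := fun s hs =>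
    correctCount_eq_top.2 (frequently_atTop.2 fun N => by
      have := hx (⟨s, hs⟩, N, true)
      simpa [M] using this)
  have h2 : ∀ s ∈ S, incorrectCount s (e ∘ x) = ⊤ := fun s hs =>
    incorrectCount_eq_top.2 (frequently_atTop.2 fun N => by
      have := hx (⟨s, hs⟩, N, false)
      simpa [M] using this)
  exact ⟨e ∘ x, trivial, fun h => ne_of_incorrectCount_eq_top (h2 _ h) rfl, fun s hs =>
    Prod.ext (h1 s hs) (h2 s hs)⟩

/-- The finite partial injections from `A` to `C`, as graphs. -/
def FinPartialInjection (A C : Type) : Type :=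
  {p : Finset (A × C) // ∀ a ∈ p, ∀ b ∈ p, a.1 = b.1 ↔ a.2 = b.2}

instance (A C : Type) : Preorder (FinPartialInjection A C) where
  le q p := p.1 ⊆ q.1
  le_refl _ := subset_refl _
  le_trans _ _ _ h h' := h'.trans h

instance (A C : Type) [Countable A] [Countable C] : Countable (FinPartialInjection A C) :=
  inferInstanceAs (Countable {p : Finset (A × C) //
    ∀ a ∈ p, ∀ b ∈ p, a.1 = b.1 ↔ a.2 = b.2})

instance (A C : Type) : Nonempty (FinPartialInjection A C) := ⟨⟨∅, by simp⟩⟩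

theorem FinPartialInjection.exists_insert {A C : Type} (p : FinPartialInjection A C) {a : A} {c : C}
    (ha : ∀ x ∈ p.1, x.1 ≠ a) (hc : ∀ x ∈ p.1, x.2 ≠ c) : ∃ q ≤ p, (a, c) ∈ q.1 := by
  classical
  refine ⟨⟨insert (a, c) p.1, fun x hx y hy => ?_⟩, Finset.subset_insert _ _,
    Finset.mem_insert_self _ _⟩
  rcases Finset.mem_insert.1 hx with rfl | hx <;> rcases Finset.mem_insert.1 hy with rfl | hy
  · simp
  · simp [(ha y hy).symm, (hc y hy).symm]
  · simp [ha x hx, hc x hx]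
  · exact p.2 x hx y hy

theorem exists_generic_injection {A C : Type} [Countable A] [Countable C] [Infinite C] {ι : Type}
    (hι : #ι < covMeager) (a : ι → ℕ → A) (c : ι → ℕ → C) (ha : ∀ i, Function.Injective (a i))
    (hc : ∀ i, Function.Injective (c i)) :
    ∃ g : A → C, Function.Injective g ∧ ∀ i, ∃ᶠ n in atTop, g (a i n) = c i n := by
  classical
  let D : (ι × ℕ) ⊕ A → Set (FinPartialInjection A C) := Sum.elim
    (fun i => {p | ∃ n ≥ i.2, (a i.1 n, c i.1 n) ∈ p.1}) (fun x => {p | ∃ y, (x, y) ∈ p.1})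
  have hD : ∀ j, IsDenseSubset (D j) := by
    rintro (⟨i, N⟩ | x) p
    · have h1 : {n | ∃ x ∈ p.1, x.1 = a i n}.Finite :=
        ((p.1.image Prod.fst).finite_toSet.preimage (ha i).injOn).subset fun n ⟨x, hx, h⟩ => by
          simpa using ⟨x.2, h ▸ hx⟩
      have h2 : {n | ∃ x ∈ p.1, x.2 = c i n}.Finite :=
        ((p.1.image Prod.snd).finite_toSet.preimage (hc i).injOn).subset fun n ⟨x, hx, h⟩ => by
          simpa using ⟨x.1, h ▸ hx⟩
      obtain ⟨n, hn⟩ := ((h1.union h2).union (Set.finite_Iio N)).infinite_compl.nonempty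
      simp only [Set.mem_compl_iff, Set.mem_union, not_or, Set.mem_ofPred_eq, not_exists, not_and,
        Set.mem_Iio, not_lt] at hn
      obtain ⟨q, hq, hmem⟩ := p.exists_insert hn.1.1 hn.1.2
      exact ⟨q, ⟨n, hn.2, hmem⟩, hq⟩
    · by_cases hx : ∃ y, (x, y) ∈ p.1
      · exact ⟨p, hx, le_rfl⟩
      · obtain ⟨y, hy⟩ := Infinite.exists_notMem_finset (p.1.image Prod.snd)
        obtain ⟨q, hq, hmem⟩ := p.exists_insert (a := x) (c := y)
          (fun z hz h => hx ⟨z.2, h ▸ hz⟩) fun z hz h => hy (Finset.mem_image.2 ⟨z, hz, h⟩)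
        exact ⟨q, ⟨y, hmem⟩, hq⟩
  have hcard : #((ι × ℕ) ⊕ A) < covMeager := by
    rw [Cardinal.mk_sum, Cardinal.lift_id, Cardinal.lift_id]
    exact Cardinal.add_lt_of_lt aleph0_lt_covMeager.le
      (mk_prod_countable_lt aleph0_lt_covMeager hι)
      (Cardinal.mk_le_aleph0.trans_lt aleph0_lt_covMeager)
  obtain ⟨p, hp, hpD⟩ := exists_antitone_of_lt_covMeager D hD hcard
  have hcompat : ∀ {m n x y}, x ∈ (p m).1 → y ∈ (p n).1 → (x.1 = y.1 ↔ x.2 = y.2) :=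
    fun {m n x y} hx hy => (p (max m n)).2 x (hp (le_max_left m n) hx) y
      (hp (le_max_right m n) hy)
  choose k g hg using fun x => hpD (Sum.inr x)
  refine ⟨g, fun x y hxy => (hcompat (hg x) (hg y)).2 hxy, fun i => frequently_atTop.2 fun N => ?_⟩
  obtain ⟨m, n, hn, hmem⟩ := hpD (Sum.inl (i, N))
  exact ⟨n, hn, (hcompat (hg _) hmem).1 rfl⟩

/-- Exchanging the positions `2 * n` and `2 * n + 1` for `n ∈ X`. -/
theorem exists_involutive_swap (X : Set ℕ) : ∃ τ : ℕ → ℕ, Function.Involutive τ ∧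
    (∀ n ∈ X, τ (2 * n) = 2 * n + 1 ∧ τ (2 * n + 1) = 2 * n) ∧ ∀ m, m / 2 ∉ X → τ m = m := by
  classical
  let τ : ℕ → ℕ := fun m => if m / 2 ∈ X then 2 * (m / 2) + (1 - m % 2) else m
  have hpos : ∀ m, m / 2 ∈ X → τ m = 2 * (m / 2) + (1 - m % 2) := fun m hm => if_pos hm
  have hneg : ∀ m, m / 2 ∉ X → τ m = m := fun m hm => if_neg hm
  refine ⟨τ, fun m => ?_, fun n hn => ⟨?_, ?_⟩, hneg⟩
  · by_cases hm : m / 2 ∈ X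
    · have hdiv : τ m / 2 = m / 2 := by rw [hpos m hm]; omega
      rw [hpos (τ m) (by rwa [hdiv]), hdiv, hpos m hm]
      omega
    · rw [hneg m hm, hneg m hm]
  · rw [hpos _ (by rwa [show 2 * n / 2 = n by omega])]; omega
  · rw [hpos _ (by rwa [show (2 * n + 1) / 2 = n by omega])]; omega

variable {C : Type}

theorem rearrangementCount_eq_top {s w : ℕ → C} (hs : Function.Injective s)
    (hw : Function.Injective w) (h : ∃ᶠ n in atTop, w (2 * n + 1) = s (2 * n)) :
    rearrangementCount s w = ⊤ := by
  obtain ⟨τ, hτ, hX, hτX⟩ := exists_involutive_swap {n | w (2 * n + 1) = s (2 * n)}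
  have heven : ∀ n, w (2 * n + 1) = s (2 * n) → s (2 * n) ≠ w (2 * n) := fun n hn h => by
    have := hw (hn.trans h)
    omega
  have hodd : ∀ n, w (2 * n + 1) = s (2 * n) → s (2 * n + 1) ≠ w (2 * n + 1) := fun n hn h => by
    have := hs (h.trans hn)
    omega
  have hinv : ∀ m, s (hτ.toPerm τ m) ≠ w (hτ.toPerm τ m) ↔ s m ≠ w m := by
    intro m
    change s (τ m) ≠ w (τ m) ↔ _
    by_cases hm : w (2 * (m / 2) + 1) = s (2 * (m / 2))
    · have hτm := hX _ hm
      rcases Nat.mod_two_eq_zero_or_one m with h0 | h0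
      · have hm' : m = 2 * (m / 2) := by omega
        rw [hm', hτm.1]
        exact iff_of_true (hodd _ hm) (heven _ hm)
      · have hm' : m = 2 * (m / 2) + 1 := by omega
        rw [hm', hτm.2]
        exact iff_of_true (heven _ hm) (hodd _ hm)
    · rw [hτX m hm]
  refine top_unique (le_trans (le_of_eq ?_) (le_iSup _ ((hτ.toPerm τ).subtypePerm hinv)))
  rw [eq_comm, Set.encard_eq_top_iff]
  have hinf := Nat.frequently_atTop_iff_infinite.1 h
  refine Set.infinite_of_injOn_mapsTo (s := Set.univ)
    (f := fun n : {n | w (2 * n + 1) = s (2 * n)} =>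
      (⟨2 * n.1 + 1, hodd n.1 n.2⟩ : {n // s n ≠ w n})) (fun m _ n _ hmn => ?_) (fun n _ => ?_) ?_
  · have := congrArg Subtype.val hmn
    dsimp only at this
    exact Subtype.ext (by omega)
  · change s (τ (2 * n.1 + 1)) = w (2 * n.1 + 1)
    rw [(hX n.1 n.2).2]
    exact n.2.symm
  · have := hinf.to_subtype
    exact Set.infinite_univ

theorem errorCount_eq_top {s w : ℕ → C} (h : ∃ᶠ n in atTop, s n ∉ Set.range w) :
    errorCount s w = ⊤ := by
  refine iInf_eq_top.2 fun π => ?_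
  rw [Set.encard_eq_top_iff]
  have hinf := Nat.frequently_atTop_iff_infinite.1 h
  refine Set.infinite_of_injOn_mapsTo (s := Set.univ)
    (f := fun n : {n | s n ∉ Set.range w} =>
      π.symm (⟨n.1, fun h => n.2 ⟨n.1, h.symm⟩⟩ : {n // s n ≠ w n}))
    (fun m _ n _ hmn => ?_) (fun n _ => ?_) ?_
  · have := congrArg Subtype.val (π.symm.injective hmn)
    exact Subtype.ext this
  · change s (π (π.symm _)) ≠ w _
    rw [Equiv.apply_symm_apply]
    exact fun h => n.2 ⟨_, h.symm⟩
  · have := hinf.to_subtype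
    exact Set.infinite_univ

theorem exists_generic_injWord [Countable C] [Infinite C] {S : Set (ℕ → C)} (hS : S ⊆ injWords C)
    (hc : #S < covMeager) : ∃ w ∈ injWords C, w ∉ S ∧ ∀ s ∈ S,
      fullFeedback s w = (⊤, ⊤, ⊤) ∧ incorrectCount s w = ⊤ := by
  obtain ⟨g, hg, hfreq⟩ := exists_generic_injection (A := ℕ ⊕ ℕ) (C := C) (ι := S × Fin 3)
    (mk_prod_countable_lt aleph0_lt_covMeager hc)
    (fun i n => ![Sum.inl n, Sum.inr n, Sum.inl (2 * n + 1)] i.2)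
    (fun i n => ![i.1.1 n, i.1.1 n, i.1.1 (2 * n)] i.2)
    (by
      rintro ⟨s, i⟩ m n hmn
      fin_cases i <;> simpa using hmn)
    (by
      rintro ⟨s, i⟩ m n hmn
      fin_cases i
      · exact hS s.2 hmn
      · exact hS s.2 hmn
      · have := hS s.2 hmn
        omega)
  have hw : Function.Injective fun n => g (Sum.inl n) := hg.comp Sum.inl_injective
  have hfb : ∀ s ∈ S, fullFeedback s (fun n => g (Sum.inl n)) = (⊤, ⊤, ⊤) ∧
      incorrectCount s (fun n => g (Sum.inl n)) = ⊤ := by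
    intro s hs
    have hrange : ∃ᶠ n in atTop, s n ∉ Set.range fun n => g (Sum.inl n) :=
      (hfreq (⟨s, hs⟩, 1)).mono fun n hn ⟨m, hm⟩ => by
        have := hg (hm.trans hn.symm)
        simp at this
    refine ⟨Prod.ext (correctCount_eq_top.2 ((hfreq (⟨s, hs⟩, 0)).mono fun n hn => hn.symm))
      (Prod.ext (rearrangementCount_eq_top (hS hs) hw (hfreq (⟨s, hs⟩, 2)))
        (errorCount_eq_top hrange)), ?_⟩
    exact incorrectCount_eq_top.2 (hrange.mono fun n hn h => hn ⟨n, h.symm⟩)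
  exact ⟨_, hw, fun h => ne_of_incorrectCount_eq_top (hfb _ h).2 rfl, hfb⟩

theorem hasGeneric_injWords_fullFeedback [Countable C] [Infinite C] :
    HasGeneric (injWords C) fullFeedback covMeager (⊤, ⊤, ⊤) := fun _ hS hc =>
  let ⟨w, hw, hwS, h⟩ := exists_generic_injWord hS hc
  ⟨w, hw, hwS, fun s hs => (h s hs).1⟩

theorem hasGeneric_injWords_simplifiedFeedback [Countable C] [Infinite C] :
    HasGeneric (injWords C) simplifiedFeedback covMeager (⊤, ⊤) := fun _ hS hc =>
  let ⟨w, hw, hwS, h⟩ := exists_generic_injWord hS hc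
  ⟨w, hw, hwS, fun s hs => Prod.ext (congrArg (fun r => r.1) (h s hs).1 :) (h s hs).2⟩

end GenericWords

section FiniteColors

variable {F : Type}

/-- A continuum of words over finitely many colors: the positions are identified with finite
functions `φ` from binary strings of a common length to colors, and the color of the word of `x`
at position `φ` is the value of `φ` at an initial segment of `x`. -/
theorem exists_independent_words (F : Type) [Finite F] [Nontrivial F] :
    ∃ v : (ℕ → Bool) → ℕ → F, ∀ x : F → ℕ → Bool, Function.Injective x →
      ∃ᶠ n in atTop, ∀ c, v (x c) n = c := by
  classical
  obtain ⟨d, hd⟩ := exists_surjective_nat (Σ m : ℕ, ((Fin m → Bool) → F))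
  refine ⟨fun x n => (d n).2 fun i => x i, fun x hx => ?_⟩
  have hsep : ∀ a b : F, ∃ m, a ≠ b → ∃ i < m, x a i ≠ x b i := by
    intro a b
    by_cases hab : a = b
    · exact ⟨0, fun h => (h hab).elim⟩
    · obtain ⟨i, hi⟩ := Function.ne_iff.1 (hx.ne hab)
      exact ⟨i + 1, fun _ => ⟨i, i.lt_succ_self, hi⟩⟩
  choose m hm using hsep
  obtain ⟨M, hM⟩ := (Set.finite_range fun ab : F × F => m ab.1 ab.2).bddAbove
  have hinj : ∀ N ≥ M, Function.Injective fun (c : F) (i : Fin N) => x c i := by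
    intro N hN a b hab
    by_contra hne
    obtain ⟨i, hi, hxi⟩ := hm a b hne
    exact hxi (congrFun hab ⟨i, hi.trans_le ((hM ⟨(a, b), rfl⟩).trans hN)⟩)
  choose k hk using fun N : ℕ => hd ⟨N, Function.invFun fun (c : F) (i : Fin N) => x c i⟩
  have hkinj : Function.Injective k := fun a b hab => by
    have := congrArg Sigma.fst ((hk a).symm.trans ((congrArg d hab).trans (hk b)))
    exact this
  rw [Nat.frequently_atTop_iff_infinite]
  refine ((Set.Ici_infinite M).image hkinj.injOn).mono ?_
  rintro _ ⟨N, hN, rfl⟩ c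
  dsimp only
  rw [hk N]
  exact Function.leftInverse_invFun (hinj N hN) c

theorem exists_injective_mem_of_infinite [Finite F] {T : Type} {X : Set T} (hX : X.Infinite) :
    ∃ x : F → T, Function.Injective x ∧ ∀ c, x c ∈ X := by
  obtain ⟨e, he⟩ := exists_injective_nat F
  let g := hX.natEmbedding
  exact ⟨fun c => g (e c), fun a b hab => he (g.injective (Subtype.ext hab)),
    fun c => (g (e c)).2⟩

theorem hasGeneric_allWords_of_finite (F : Type) [Finite F] [Nontrivial F] :
    HasGeneric (allWords F) simplifiedFeedback 𝔠 (⊤, ⊤) := by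
  intro S _ hc
  obtain ⟨v, hv⟩ := exists_independent_words F
  obtain ⟨x, -, hx⟩ := exists_notMem_of_mk_lt Cardinal.aleph0_lt_continuum hc
    (X := (Set.univ : Set (ℕ → Bool))) (by rw [Cardinal.mk_univ, mk_boolSeq])
    (fun s : S => {x | ∀ᶠ n in atTop, s.1 n ≠ v x n} ∪ {x | ∀ᶠ n in atTop, s.1 n = v x n})
    fun s => by
      refine (Set.Finite.union ?_ ?_).countable <;> by_contra hinf
      · obtain ⟨x, hx, hmem⟩ := exists_injective_mem_of_infinite (F := F) hinf
        obtain ⟨n, hn, hne⟩ := ((hv x hx).and_eventually (eventually_all.2 hmem)).exists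
        exact hne (s.1 n) (hn _).symm
      · obtain ⟨x, hx, hmem⟩ := exists_injective_mem_of_infinite (F := F) hinf
        obtain ⟨n, hn, heq⟩ := ((hv x hx).and_eventually (eventually_all.2 hmem)).exists
        obtain ⟨a, b, hab⟩ := exists_pair_ne F
        exact hab (by rw [← hn a, ← hn b, ← heq a, ← heq b])
  have h2 : ∀ s ∈ S, incorrectCount s (v x) = ⊤ := fun s hs =>
    incorrectCount_eq_top.2 fun h => hx ⟨s, hs⟩ (Or.inr (h.mono fun n hn => not_not.1 hn))
  exact ⟨v x, trivial, fun h => ne_of_incorrectCount_eq_top (h2 _ h) rfl, fun s hs =>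
    Prod.ext (correctCount_eq_top.2 fun h => hx ⟨s, hs⟩ (Or.inl h)) (h2 s hs)⟩

end FiniteColors

section FullFeedback

variable {C : Type}

open Classical in
theorem rearrangementCount_update_const_eq_zero {c d : C} {n : ℕ} {w : ℕ → C} (hw : w n = c) :
    rearrangementCount (Function.update (fun _ => d) n c) w = 0 := by
  have hI : ∀ m, Function.update (fun _ => d) n c m ≠ w m →
      Function.update (fun _ => d) n c m = d ∧ w m ≠ d := by
    intro m hm
    rcases eq_or_ne m n with rfl | hmn
    · rw [Function.update_self] at hm
      exact (hm hw.symm).elim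
    · rw [Function.update_of_ne hmn] at hm ⊢
      exact ⟨rfl, hm.symm⟩
  refine ENat.iSup_eq_zero.2 fun π => ?_
  rw [Set.encard_eq_zero, Set.eq_empty_iff_forall_notMem]
  intro m hm
  rw [Set.mem_ofPred_eq, (hI _ (π m).2).1] at hm
  exact (hI _ m.2).2 hm.symm

open Classical in
theorem rearrangementCount_update_const_ne_zero {c d : C} (hcd : c ≠ d) {n m : ℕ} {w : ℕ → C}
    (hn : w n = d) (hm : w m ≠ d) :
    rearrangementCount (Function.update (fun _ => d) n c) w ≠ 0 := by
  intro h0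
  have hmn : m ≠ n := fun h => hm (h ▸ hn)
  let n' : {k // Function.update (fun _ => d) n c k ≠ w k} :=
    ⟨n, by rwa [Function.update_self, hn]⟩
  let m' : {k // Function.update (fun _ => d) n c k ≠ w k} :=
    ⟨m, by rw [Function.update_of_ne hmn]; exact hm.symm⟩
  have := ENat.iSup_eq_zero.1 h0 (Equiv.swap n' m')
  rw [Set.encard_eq_zero, Set.eq_empty_iff_forall_notMem] at this
  refine this n' ?_
  rw [Set.mem_ofPred_eq, Equiv.swap_apply_left]
  change Function.update (fun _ => d) n c m = w n
  rw [Function.update_of_ne hmn, hn]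

theorem errorCount_self (w : ℕ → C) : errorCount w w = 0 := by
  refine nonpos_iff_eq_zero.1 ((iInf_le _ 1).trans (le_of_eq ?_))
  rw [Set.encard_eq_zero, Set.eq_empty_iff_forall_notMem]
  exact fun m _ => m.2 rfl

theorem errorCount_const_ne_zero {d : C} {w : ℕ → C} {n : ℕ} (hn : w n ≠ d) :
    errorCount (fun _ => d) w ≠ 0 := by
  rw [← Order.one_le_iff_ne_zero]
  refine le_iInf fun π => Set.one_le_encard_iff_nonempty.2 ⟨⟨n, hn.symm⟩, hn.symm⟩

open Classical in
theorem exists_countable_isWinningSet_fullFeedback (C : Type) [Countable C] :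
    ∃ S : Set (ℕ → C), S.Countable ∧ IsWinningSet (allWords C) fullFeedback S := by
  refine ⟨Set.range (fun (d : C) (_ : ℕ) => d) ∪
      Set.range fun a : ℕ × C × C => Function.update (fun _ => a.2.2) a.1 a.2.1,
    (Set.countable_range _).union (Set.countable_range _), Set.subset_univ _,
    fun w _ w' _ h => ?_⟩
  by_contra hne
  obtain ⟨n, hn⟩ := Function.ne_iff.1 hne
  by_cases hconst : ∃ m, w m ≠ w n
  · obtain ⟨m, hm⟩ := hconst
    refine rearrangementCount_update_const_ne_zero hn.symm rfl hm ?_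
    have := congrArg (fun r => r.2.1) (h _ (Or.inr ⟨(n, w' n, w n), rfl⟩))
    exact this.trans (rearrangementCount_update_const_eq_zero rfl)
  · push Not at hconst
    have hw : w = fun _ => w n := funext hconst
    have := congrArg (fun r => r.2.2) (h _ (Or.inl ⟨w n, rfl⟩))
    refine errorCount_const_ne_zero (d := w n) (w := w') hn.symm (this.symm.trans ?_)
    change errorCount (fun _ => w n) w = 0
    rw [← hw]
    exact errorCount_self w

theorem not_countable_allWords [Nontrivial C] : ¬ (allWords C).Countable := fun h =>
  (continuum_le_mk_allWords (C := C)).not_gt (h.le_aleph0.trans_lt Cardinal.aleph0_lt_continuum)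

theorem strategicNumber_allWords_fullFeedback (C : Type) [Countable C] [Nontrivial C] :
    strategicNumber (allWords C) fullFeedback = ω + 1 := by
  obtain ⟨S, hSc, hS⟩ := exists_countable_isWinningSet_fullFeedback C
  obtain ⟨σ, hσ⟩ := hS.exists_winsBefore_omega0_add_one hSc Set.univ_nonempty
  exact strategicNumber_eq hσ fun τ δ hτ => omega0_lt_of_winsBefore not_countable_allWords hτ

end FullFeedback

section Results

theorem strategicNumber_incorrectCount {C : Type} [Countable C] {W : Set (ℕ → C)} (hW : 𝔠 ≤ #W) :
    strategicNumber W incorrectCount = Cardinal.ord 𝔠 := by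
  have hne : W.Nonempty := by
    rw [← Set.nonempty_coe_sort, ← Cardinal.mk_ne_zero_iff]
    exact (Cardinal.continuum_pos.trans_le hW).ne'
  exact (numbers_eq Cardinal.aleph0_lt_continuum hne (hasGeneric_incorrectCount hW)
    (isBlockFamily_incorrectCount W)).1

theorem numbers_eq_of_simplifiedFeedback {C : Type} {W : Set (ℕ → C)} {κ : Cardinal.{0}}
    (hκ : ℵ₀ < κ) (hW : W.Nonempty) (hgen : HasGeneric W simplifiedFeedback κ (⊤, ⊤)) {ι : Type}
    {B : ι → Set (ℕ → C)} (hB : IsBlockFamily W correctCount κ B) :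
    (strategicNumber W simplifiedFeedback = κ.ord ∧ mastermindNumber W simplifiedFeedback = κ) ∧
      strategicNumber W correctCount = κ.ord ∧ mastermindNumber W correctCount = κ :=
  ⟨numbers_eq hκ hW hgen (hB.comp Prod.fst fun _ _ => rfl),
    numbers_eq hκ hW (hgen.comp Prod.fst fun _ _ => rfl) hB⟩

theorem allWords_nonempty (C : Type) [Nonempty C] : (allWords C).Nonempty := Set.univ_nonempty

theorem injWords_nonempty (C : Type) [Infinite C] : (injWords C).Nonempty :=
  ⟨Infinite.natEmbedding C, (Infinite.natEmbedding C).injective⟩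

end Results

end InfiniteMastermind

open InfiniteMastermind in
theorem mainTheorem3
    -- `C` is a countably infinite set of colors, `F` a finite set of at least two colors
    (C : Type) [Countable C] [Infinite C] (F : Type) [Finite F] [Nontrivial F] :
    -- (1) duplication allowed, full feedback
    (strategicNumber (allWords C) fullFeedback = ω + 1 ∧
      strategicNumber (allWords F) fullFeedback = ω + 1) ∧
    -- (2) no duplication: full, simplified and correctness-only feedback
    ((strategicNumber (injWords C) fullFeedback =
          (mastermindNumber (injWords C) fullFeedback).ord ∧
        strategicNumber (injWords C) simplifiedFeedback =
          (mastermindNumber (injWords C) simplifiedFeedback).ord ∧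
        strategicNumber (injWords C) correctCount =
          (mastermindNumber (injWords C) correctCount).ord) ∧
      (mastermindNumber (injWords C) fullFeedback = covMeager ∧
        mastermindNumber (injWords C) simplifiedFeedback = covMeager ∧
        mastermindNumber (injWords C) correctCount = covMeager) ∧
      covMeager = martinNumber CohenCondition) ∧
    -- (3) duplication allowed: simplified and correctness-only feedback
    ((strategicNumber (allWords C) simplifiedFeedback =
          (mastermindNumber (allWords C) simplifiedFeedback).ord ∧
        strategicNumber (allWords C) correctCount =
          (mastermindNumber (allWords C) correctCount).ord) ∧
      (mastermindNumber (allWords C) simplifiedFeedback = covMeager ∧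
        mastermindNumber (allWords C) correctCount = covMeager)) ∧
    -- (4) the same with finitely many colors
    ((strategicNumber (allWords F) simplifiedFeedback =
          (mastermindNumber (allWords F) simplifiedFeedback).ord ∧
        strategicNumber (allWords F) correctCount =
          (mastermindNumber (allWords F) correctCount).ord) ∧
      (mastermindNumber (allWords F) simplifiedFeedback = 𝔠 ∧
        mastermindNumber (allWords F) correctCount = 𝔠)) ∧
    -- (5) incorrectness-only feedback
    (strategicNumber (allWords C) incorrectCount = Cardinal.ord 𝔠 ∧
      strategicNumber (allWords F) incorrectCount = Cardinal.ord 𝔠 ∧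
      strategicNumber (injWords C) incorrectCount = Cardinal.ord 𝔠) := by
  obtain ⟨ι, B, hB⟩ := exists_isBlockFamily_injWords C
  obtain ⟨ι', B', hB'⟩ := exists_isBlockFamily_allWords C
  obtain ⟨hfs, hfm⟩ := numbers_eq aleph0_lt_covMeager (injWords_nonempty C)
    hasGeneric_injWords_fullFeedback (hB.comp Prod.fst fun _ _ => rfl)
  obtain ⟨⟨hss, hsm⟩, hcs, hcm⟩ := numbers_eq_of_simplifiedFeedback aleph0_lt_covMeager
    (injWords_nonempty C) hasGeneric_injWords_simplifiedFeedback hB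
  obtain ⟨⟨hss', hsm'⟩, hcs', hcm'⟩ := numbers_eq_of_simplifiedFeedback aleph0_lt_covMeager
    (allWords_nonempty C) (hasGeneric_allWords C) hB'
  choose o ho using fun c : F => exists_ne c
  obtain ⟨⟨hssF, hsmF⟩, hcsF, hcmF⟩ := numbers_eq_of_simplifiedFeedback
    Cardinal.aleph0_lt_continuum (allWords_nonempty F) (hasGeneric_allWords_of_finite F)
    (isBlockFamily_allWords (mk_words_le_continuum (allWords F)) Subtype.val fun w =>
      ⟨⟨fun n => o (w n), trivial⟩, Filter.Eventually.of_forall fun _ => ho _⟩)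
  refine ⟨⟨strategicNumber_allWords_fullFeedback C, strategicNumber_allWords_fullFeedback F⟩,
    ⟨⟨?_, ?_, ?_⟩, ⟨hfm, hsm, hcm⟩, covMeager_eq_martinNumber⟩,
    ⟨⟨?_, ?_⟩, hsm', hcm'⟩, ⟨⟨?_, ?_⟩, hsmF, hcmF⟩,
    strategicNumber_incorrectCount continuum_le_mk_allWords,
    strategicNumber_incorrectCount continuum_le_mk_allWords,
    strategicNumber_incorrectCount continuum_le_mk_injWords⟩
  · rw [hfs, hfm]
  · rw [hss, hsm]
  · rw [hcs, hcm]
  · rw [hss', hsm']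
  · rw [hcs', hcm']
  · rw [hssF, hsmF]
  · rw [hcsF, hcmF]
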